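/- **Notation.** Let $d\ge 2$, write points of $\mathbb R^d$ as $z=(t,x)$, $t\in\mathbb R$, $x\in\mathbb R^{d-1}$, and fix the scaling $\mathfrak s=(2,1,\dots,1)$ with $\|z-z'\|_{\mathfrak s}=\sum_i|z_i-z_i'|^{1/\mathfrak s_i}$ and $|k|_{\mathfrak s}=\sum_i\mathfrak s_ik_i$. Let $D\subset\mathbb R^{d-1}$ be a bounded domain, $P_0=\{t=0\}$, $P_1=\mathbb R\times\partial D$, $P=P_0\cup P_1$, $D_\tau=[0,\tau]\times D$ and $|z|_{P_i}=1\wedge d_{\mathfrak s}(z,P_i)$. Let $\mathbf R^D_+$ be the indicator function of $(0,\infty)\times D$, and write $\psi_z^\lambda$ for $\psi$ rescaled (with respect to $\mathfrak s$) to scale $\lambda$ around $z$. Let $\mathscr T=(A,T,G)$ be a regularity structure containing the polynomial structure $\bar T$. For a model $(\Pi,\Gamma)$, a sector $V$, $\gamma>0$ and $w=(\eta,\sigma,\mu)$, the space $\mathcal D^{\gamma,w}_P(V,\Gamma)$ up to time $\tau$ consists of the functions $f$ on $D_\tau\setminus P$ with values in $V_\gamma^-$ (components of degree $<\gamma$)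 with finite norm $|||f|||_{\gamma,w;D_\tau}$, the sum of the three suprema $$\sup\frac{\|f(z)-\Gamma_{zz'}f(z')\|_l}{\|z-z'\|_{\mathfrak s}^{\gamma-l}\,p_0^{\eta-\gamma}\,p_1^{\sigma-\gamma}(p_0\vee p_1)^{\mu-\eta-\sigma+\gamma}},\quad \sup_{|z|_{P_0}\le|z|_{P_1}}\frac{\|f(z)\|_l}{|z|_{P_1}^{\mu-l}(|z|_{P_0}/|z|_{P_1})^{(\eta-l)\wedge0}},\quad \sup_{|z|_{P_1}\le|z|_{P_0}}\frac{\|f(z)\|_l}{|z|_{P_0}^{\mu-l}(|z|_{P_1}/|z|_{P_0})^{(\sigma-l)\wedge0}}$$ over $l<\gamma$ and $z,z'\in D_\tau\setminus P$, where $p_i=|z|_{P_i}\wedge|z'|_{P_i}$ and the first supremum is over $z\ne z'$ with $2\|z-z'\|_{\mathfrak s}\le p_0\wedge p_1$. For two models, $|||f;g|||_{\gamma,w;D_\tau}$ is the same expression with $f(z)-g(z)-\Gamma_{zz'}f(z')+\bar\Gamma_{zz'}g(z')$ as increment and $f-g$ as value. For $a=(a_0,a_1,a_\cap)$ with nonpositive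 entries, $\mathcal C^a_P$ consists of the distributions $u\in\mathcal C^{a_0\wedge a_1\wedge a_\cap}$ vanishing outside $\mathbb R_+\times D$ for which $\|u\|_{a}$ is finite, where $\|u\|_a$ is the best constant in $|u(\psi_z^\lambda)|\le C|z|_{P_1}^{a_\cap-a_0}\lambda^{a_0}$ (for $|z|_{P_0}\le2|z|_{P_1}$, $2\lambda\le|z|_{P_1}$) and $|u(\psi_z^\lambda)|\le C|z|_{P_0}^{a_\cap-a_1}\lambda^{a_1}$ (for $|z|_{P_1}\le2|z|_{P_0}$, $2\lambda\le|z|_{P_0}$), over $\lambda\in(0,1]$ and $\psi$ smooth, supported in the unit ball, with derivatives up to order $\lceil-a_0+1\rceil$ resp. $\lceil-a_1+1\rceil$ bounded by $1$; $\|u\|_{a;\tau}$ is the same with only test functions $\psi_z^\lambda$ supported in $(-\infty,\tau]\times\mathbb R^{d-1}$. A *time-indexed space* $\mathcal V$ is a family of Banach spaces $\mathcal V_\tau$, $\tau>0$, with consistent linear contractions $\mathcal V_\tau\to\mathcal V_{\tau'}$, $\tau'\le\tau$ (restrictions); it is also viewed as the Fréchet space of consistent families $v=(v_\tau)_{\tau>0}$.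 A map $A:\mathcal V\to\bar{\mathcal V}$ is *adapted* if it is given by maps $A_\tau:\mathcal V_\tau\to\bar{\mathcal V}_\tau$ that commute with the restrictions; if it is linear, $\|A_\tau\|$ is required to be bounded for $\tau$ in bounded sets. The spaces $\mathcal D^{\gamma,w}_P$ and $\mathcal C^a_P$ are regarded as time-indexed through the norms above. **Setting.** 1. $\gamma,\gamma_0>0$, $\gamma<\gamma_0+2$; $V$ is a sector of regularity $\alpha\le0$ with $\bar T\subset V$; $w\in\mathbb R^3$. 2. $\mathcal I$ is an abstract integration map of order $2$; $K=\sum_mK_m\in\mathscr K_2$ and $Z=\sum_mZ_m\in\mathscr Z_{2,P}$ are non-anticipative. Here $\mathscr K_2$ is the usual class of singular kernels that are regularising of order $2$ ($K_m$ smooth, supported in $\|z-z'\|_{\mathfrak s}\le2^{-m}$, $|D_1^kD_2^lK_m|\lesssim2^{m(|\mathfrak s|+|k+l|_{\mathfrak s}-2)}$, moments of $D_i^kK_m$ of order $2^{-2m}$, and $K_m$ annihilates polynomials up to some positive degree), and $\mathscr Z_{2,P}$ is defined by $|D_1^kD_2^lZ_m|\lesssim2^{m(|\mathfrak s|+|k+l|_{\mathfrak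 s}-2)}$ and $|z|_{P_1}+|z'|_{P_1}+|t-t'|^{1/2}\le C2^{-m}$ on the support of the smooth function $Z_m$ (whose sections $Z_m(z,\cdot)$ are compactly supported). 3. $(\Pi^\varepsilon,\Gamma^\varepsilon)$, $\varepsilon\in[0,1]$, are models that are compatible with polynomials and realise $K$ for $\mathcal I$, and $(\Pi^\varepsilon,\Gamma^\varepsilon)\to(\Pi^0,\Gamma^0)$ as $\varepsilon\to0$. 4. $\mathcal V_\varepsilon$, $\varepsilon\in[0,1]$, are time-indexed spaces with adapted linear maps $\hat{\mathcal R}^\varepsilon:\mathcal V_\varepsilon\to\tilde{\mathcal C}=\bigoplus_{i=0}^N\mathcal C_P^{w_i}$ and $\iota_\varepsilon:\mathcal V_\varepsilon\to\tilde{\mathcal D}=\bigoplus_{i=0}^N\mathcal D_P^{\gamma_0,w_i}(V_i,\Gamma^\varepsilon)$, where $V_i$ is a sector of regularity $\alpha_i\le0$ on which $\mathcal I$ is defined, $\mathcal I(V_i)\subset V$, and $w_i$ has nonpositive entries. The distribution $\hat{\mathcal R}^\varepsilon v$ agrees with the local reconstruction of $\mathbf R^D_+\iota_\varepsilon v$ on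 test functions supported away from $P$. 5. $\mathcal W_\varepsilon$, $\varepsilon\in[0,1]$, are time-indexed spaces of modelled distributions in $\mathcal D_P^{\gamma,w}(V,\Gamma^\varepsilon)$. The formula (components of degree $\ge\gamma$ being dropped) $$\mathcal P^{(\varepsilon)}v=\sum_{i=0}^N\Bigl(\mathcal K_{\gamma_0}^{(\hat{\mathcal R}^\varepsilon v)_i}(\mathbf R_+^D\iota_\varepsilon v)_i+Z_{\gamma_0}(\hat{\mathcal R}^\varepsilon v)_i\Bigr)$$ defines an adapted linear map $\mathcal V_\varepsilon\to\mathcal W_\varepsilon$ whose restriction to time $\tau\in(0,1]$ has norm at most $C\tau^\theta$, with $C$ and $\theta>0$ independent of $\varepsilon$. Here $$(\mathcal K^\zeta_{\gamma_0}f)(z)=\mathcal If(z)+\mathcal J(z)f(z)+\sum_{|k|_{\mathfrak s}<\gamma_0+2}\tfrac{X^k}{k!}\sum_m(\zeta-\Pi_zf(z))(D_1^kK_m(z,\cdot)),$$ $$\mathcal J(z)a=\sum_{|k|_{\mathfrak s}<\beta+2}\tfrac{X^k}{k!}\sum_m(\Pi_za)(D_1^kK_m(z,\cdot))\quad(a\in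 T_\beta),\qquad (Z_{\gamma_0}\zeta)(z)=\sum_{|k|_{\mathfrak s}<\gamma_0+2}\tfrac{X^k}{k!}\sum_m\zeta(D_1^kZ_m(z,\cdot)).$$ 6. $F_\varepsilon:\mathcal W_\varepsilon\to\mathcal V_\varepsilon$ are adapted and locally Lipschitz, uniformly in $\varepsilon$: on each ball of radius $K$ the Lipschitz constants of $F_{\varepsilon,\tau}$ are bounded uniformly over $\tau\in(0,\tau_0]$ and $\varepsilon\in[0,1]$, for every $K$ and $\tau_0$, and $\sup_\varepsilon\|F_{\varepsilon}(0)\|_{\mathcal V_\varepsilon;1}<\infty$. 7. There are 'distances' $|||\cdot;\cdot|||_{\mathcal W;\tau}$ on $\mathcal W_\varepsilon\times\mathcal W_0$ (possibly depending on $\varepsilon$), with values in $[0,\infty)$ and with $|||f+f';g+g'|||_{\mathcal W;\tau}\le|||f;g|||_{\mathcal W;\tau}+|||f';g'|||_{\mathcal W;\tau}$, such that, as $\varepsilon\to0$, $$\tau^{-\theta}|||\mathcal P^{(\varepsilon)}f;\mathcal P^{(0)}g|||_{\mathcal W;\tau}\lesssim|||\iota_\varepsilon f;\iota_0g|||_{\tilde{\mathcal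 D};D_\tau}+\|\hat{\mathcal R}^\varepsilon f-\hat{\mathcal R}^0g\|_{\tilde{\mathcal C};\tau}+o(1)$$ uniformly over $\tau\in(0,1]$ and over bounded $f\in\mathcal V_\varepsilon$, $g\in\mathcal V_0$, and $$|||\iota_\varepsilon F_\varepsilon(f);\iota_0F_0(g)|||_{\tilde{\mathcal D};D_\tau}+\|\hat{\mathcal R}^\varepsilon F_\varepsilon(f)-\hat{\mathcal R}^0F_0(g)\|_{\tilde{\mathcal C};\tau}\lesssim|||f;g|||_{\mathcal W;\tau}+o(1)$$ uniformly over $\tau\in(0,1]$ and over bounded $f\in\mathcal W_\varepsilon$, $g\in\mathcal W_0$ (with $o(1)$ vanishing at $\varepsilon=0$). **Theorem.** For every $R>0$ there is $T\in(0,1]$ such that for every $\tau\in(0,T]$ the following holds. For every $\varepsilon\in[0,1]$ and every $v\in\mathcal W_\varepsilon$ with $2\|v\|_{\mathcal W_\varepsilon;1}<R$, the equation $$u=\mathcal P^{(\varepsilon)}F_\varepsilon(u)+v$$ has a solution $u^\varepsilon=\mathcal S_\tau(v,\varepsilon)\in\mathcal W_\varepsilon$ on $(0,\tau)$ (that is,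 in $(\mathcal W_{\varepsilon})_\tau$) with norm at most $R$, and it is unique in the following sense: * it is the only solution on $(0,\tau)$ in the centred ball of radius $R$ of $(\mathcal W_\varepsilon)_\tau$; * it is the only solution $u$ on $(0,\tau)$ in all of $(\mathcal W_\varepsilon)_\tau$ for which $t\mapsto\|u\|_{\mathcal W_\varepsilon;t}$ is continuous on $(0,\tau]$; * every solution on $(0,\tau)$ in $(\mathcal W_\varepsilon)_\tau$ whatsoever coincides with it on $(0,s)$ for some $s\in(0,\tau]$. Furthermore $\mathcal S_\tau$ is jointly continuous at $(v,0)$ for every $v\in\mathcal W_0$ with $2\|v\|_{\mathcal W_0;1}<R$: for every $\delta>0$ there is $\rho>0$ such that $|||\mathcal S_\tau(v',\varepsilon);\mathcal S_\tau(v,0)|||_{\mathcal W;\tau}<\delta$ whenever $\varepsilon\in[0,\rho)$, $v'\in\mathcal W_\varepsilon$, $2\|v'\|_{\mathcal W_\varepsilon;1}<R$ and $|||v';v|||_{\mathcal W;\tau}<\rho$. -/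

import Mathlib

open scoped ENNReal NNReal Topology ContDiff SchwartzMap DirectSum

noncomputable section

namespace SingularSPDE

universe u₁ u₂ u₃

/-! ### Parabolic space-time -/

/-- Space-time `ℝ^d` with `d = n + 1`; coordinate `0` is time, `Fin.tail z` is the space point. -/
abbrev Pt (n : ℕ) := Fin (n + 1) → ℝ

/-- Multi-indices on `ℝ^d`. -/
abbrev MIdx (n : ℕ) := Fin (n + 1) → ℕ

/-- The parabolic scaling `(2, 1, …, 1)`. -/
def scaling {n : ℕ} (i : Fin (n + 1)) : ℕ := if i = 0 then 2 else 1

/-- `|𝔰|`, the sum of the entries of the scaling. -/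
def scalingSum (n : ℕ) : ℕ := ∑ i : Fin (n + 1), scaling i

/-- The scaled degree `|k|_𝔰`. -/
def sdeg {n : ℕ} (k : MIdx n) : ℕ := ∑ i, scaling i * k i

/-- `d_𝔰(x,y) = ‖x - y‖_𝔰 = ∑ᵢ |xᵢ - yᵢ|^{1/𝔰ᵢ}`. -/
def sdist {n : ℕ} (x y : Pt n) : ℝ := ∑ i, |x i - y i| ^ ((1 : ℝ) / (scaling i : ℝ))

/-- The monomial `z^k`. -/
def monom {n : ℕ} (k : MIdx n) (z : Pt n) : ℝ := ∏ i, z i ^ k i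

/-- `k! = ∏ᵢ kᵢ!`. -/
def mfact {n : ℕ} (k : MIdx n) : ℝ := ∏ i, ((k i).factorial : ℝ)

/-- The finite set of multi-indices with `|k|_𝔰 < c`. -/
def below {n : ℕ} (c : ℝ) : Finset (MIdx n) :=
  (Finset.Iic (fun _ => ⌈c⌉₊)).filter (fun k => (sdeg k : ℝ) < c)

/-- Partial derivative in direction `i`. -/
def partialD {n : ℕ} (i : Fin (n + 1)) (f : Pt n → ℝ) : Pt n → ℝ :=
  fun x => fderiv ℝ f x (Pi.single i 1)

/-- `D^k f` for a multi-index `k` (used for smooth `f` only). -/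
def mderiv {n : ℕ} (k : MIdx n) (f : Pt n → ℝ) : Pt n → ℝ :=
  (List.finRange (n + 1)).foldr (fun i g => (partialD i)^[k i] g) f

/-- `D₁^k G(x, ·)` for a function `G` of two variables. -/
def D1 {n : ℕ} (k : MIdx n) (G : Pt n → Pt n → ℝ) (x : Pt n) : Pt n → ℝ :=
  fun y => mderiv k (fun x' => G x' y) x

/-- `D₂^k G(x, ·)`. -/
def D2 {n : ℕ} (k : MIdx n) (G : Pt n → Pt n → ℝ) (x : Pt n) : Pt n → ℝ :=
  mderiv k (G x)

/-! ### Test functions and functionals -/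

/-- Smooth compactly supported functions on `ℝ^d`. -/
def TestFn (n : ℕ) : Submodule ℝ (Pt n → ℝ) where
  carrier := {f | ContDiff ℝ ∞ f ∧ HasCompactSupport f}
  add_mem' hf hg := ⟨hf.1.add hg.1, hf.2.add hg.2⟩
  zero_mem' := ⟨contDiff_const, HasCompactSupport.zero⟩
  smul_mem' _ _ hf := ⟨contDiff_const.smul hf.1, hf.2.smul_left⟩

/-- Test functions supported in `(-∞, τ] × ℝ^{d-1}`. -/
def TestUpTo (n : ℕ) (τ : ℝ) : Submodule ℝ (Pt n → ℝ) where
  carrier := {f | f ∈ TestFn n ∧ ∀ z : Pt n, τ < z 0 → f z = 0}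
  add_mem' hf hg := ⟨(TestFn n).add_mem hf.1 hg.1, fun z hz => by
    simp [hf.2 z hz, hg.2 z hz]⟩
  zero_mem' := ⟨(TestFn n).zero_mem, fun _ _ => rfl⟩
  smul_mem' c _ hf := ⟨(TestFn n).smul_mem c hf.1, fun z hz => by simp [hf.2 z hz]⟩

open Classical in
/-- The value of a functional at a function, when that function is a test function. -/
def pair {n : ℕ} (ζ : TestFn n →ₗ[ℝ] ℝ) (f : Pt n → ℝ) : ℝ :=
  if h : f ∈ TestFn n then ζ ⟨f, h⟩ else 0

open Classical in
/-- The value of a tempered distribution at a function, when that function is a test function. -/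
def pairS {n : ℕ} (ξ : 𝓢(Pt n, ℝ) →L[ℝ] ℝ) (f : Pt n → ℝ) : ℝ :=
  if h : f ∈ TestFn n then ξ (HasCompactSupport.toSchwartzMap h.2 h.1) else 0

/-- The class `𝓑^r`: smooth functions supported on `B(0,1)` (in the scaled metric) with derivatives
up to order `r` bounded by `1`. -/
def IsBump {n : ℕ} (r : ℕ) (φ : Pt n → ℝ) : Prop :=
  ContDiff ℝ ∞ φ ∧ (∀ y, φ y ≠ 0 → sdist 0 y ≤ 1) ∧
    ∀ k : MIdx n, ∑ i, k i ≤ r → ∀ y, |mderiv k φ y| ≤ 1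

/-- `φ_x^δ(y) = δ^{-|𝔰|} φ(δ^{-𝔰}(y - x))`. -/
def rescale {n : ℕ} (x : Pt n) (δ : ℝ) (φ : Pt n → ℝ) : Pt n → ℝ :=
  fun y => (δ ^ scalingSum n)⁻¹ * φ (fun i => (δ ^ scaling i)⁻¹ * (y i - x i))

/-- `ψ = φ_x^δ` for some `φ ∈ 𝓑^r`. -/
def IsScaledBump {n : ℕ} (r : ℕ) (x : Pt n) (δ : ℝ) (ψ : Pt n → ℝ) : Prop :=
  ∃ φ, IsBump r φ ∧ ψ = rescale x δ φ

/-! ### Regularity structures, sectors, models -/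

/-- A regularity structure on `ℝ^{n+1}` (parabolic scaling) that contains the polynomial one.
The graded pieces are indexed by all reals and are trivial outside the index set `A`. -/
structure RegularityStructure (n : ℕ) where
  A : Set ℝ
  locallyFinite : ∀ c : ℝ, (A ∩ Set.Iic c).Finite
  T : ℝ → Type u₁
  [grp : ∀ α, NormedAddCommGroup (T α)]
  [mod : ∀ α, NormedSpace ℝ (T α)]
  [fin : ∀ α, FiniteDimensional ℝ (T α)]
  trivial_off : ∀ α, α ∉ A → Subsingleton (T α)
  /-- the structure group -/
  G : Subgroup ((⨁ α, T α) ≃ₗ[ℝ] (⨁ α, T α))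
  triangular : ∀ Γ ∈ G, ∀ (α : ℝ) (a : T α), ∀ β, α ≤ β →
    (Γ (DirectSum.lof ℝ ℝ T α a) - DirectSum.lof ℝ ℝ T α a) β = 0
  /-- the abstract monomials `X^k` -/
  X : ∀ k : MIdx n, T (sdeg k : ℝ)
  natural_mem : ∀ k : MIdx n, (sdeg k : ℝ) ∈ A
  X_indep : LinearIndependent ℝ (fun k => DirectSum.lof ℝ ℝ T (sdeg k : ℝ) (X k))
  one_norm : ‖X 0‖ = 1
  /-- `G` acts on polynomials by translations, `X^k ↦ (X + h)^k`, … -/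
  translation : ∀ Γ ∈ G, ∃ h : Pt n, ∀ k : MIdx n,
    Γ (DirectSum.lof ℝ ℝ T (sdeg k : ℝ) (X k)) =
      ∑ l ∈ Finset.Iic k, (∏ i, ((k i).choose (l i) : ℝ) * h i ^ (k i - l i)) •
        DirectSum.lof ℝ ℝ T (sdeg l : ℝ) (X l)
  /-- … and every translation occurs. -/
  translation_surj : ∀ h : Pt n, ∃ Γ ∈ G, ∀ k : MIdx n,
    Γ (DirectSum.lof ℝ ℝ T (sdeg k : ℝ) (X k)) =
      ∑ l ∈ Finset.Iic k, (∏ i, ((k i).choose (l i) : ℝ) * h i ^ (k i - l i)) •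
        DirectSum.lof ℝ ℝ T (sdeg l : ℝ) (X l)

attribute [instance] RegularityStructure.grp RegularityStructure.mod RegularityStructure.fin

variable {n : ℕ}

namespace RegularityStructure

/-- The total space `T = ⨁_α T_α`. -/
abbrev Space (𝒯 : RegularityStructure.{u₁} n) := ⨁ α, 𝒯.T α

/-- The inclusion `T_α → T`. -/
abbrev incl (𝒯 : RegularityStructure.{u₁} n) (α : ℝ) : 𝒯.T α →ₗ[ℝ] 𝒯.Space :=
  DirectSum.lof ℝ ℝ 𝒯.T α

/-- The abstract monomial `X^k` as an element of `T`. -/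
def mono (𝒯 : RegularityStructure.{u₁} n) (k : MIdx n) : 𝒯.Space :=
  𝒯.incl (sdeg k : ℝ) (𝒯.X k)

/-- The polynomial sector `T̄`. -/
def poly (𝒯 : RegularityStructure.{u₁} n) : Submodule ℝ 𝒯.Space :=
  Submodule.span ℝ (Set.range 𝒯.mono)

/-- The smallest integer `r` with `l > -r` for all `l ∈ A`. -/
def order (𝒯 : RegularityStructure.{u₁} n) : ℕ := sInf {r : ℕ | ∀ l ∈ 𝒯.A, -(r : ℝ) < l}

end RegularityStructure

/-- A sector of regularity `α ≤ 0`. -/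
structure Sector (𝒯 : RegularityStructure.{u₁} n) (α : ℝ) where
  reg_nonpos : α ≤ 0
  comp : ∀ β, Submodule ℝ (𝒯.T β)
  zero_below : ∀ β, β < α → comp β = ⊥
  invariant : ∀ Γ ∈ 𝒯.G, ∀ a : 𝒯.Space, (∀ β, a β ∈ comp β) → ∀ β, (Γ a) β ∈ comp β

/-- The sector as a subspace of `T`. -/
def Sector.toSubmodule {𝒯 : RegularityStructure.{u₁} n} {α : ℝ} (V : Sector 𝒯 α) :
    Submodule ℝ 𝒯.Space where
  carrier := {a | ∀ β, a β ∈ V.comp β}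
  add_mem' ha hb := fun β => by
    rw [DirectSum.add_apply]; exact (V.comp β).add_mem (ha β) (hb β)
  zero_mem' := fun β => by rw [DirectSum.zero_apply]; exact (V.comp β).zero_mem
  smul_mem' c a ha := fun β => by
    rw [DirectSum.smul_apply]; exact (V.comp β).smul_mem c (ha β)

/-- A model `(Π, Γ)`, compatible with the polynomials. -/
structure Model (𝒯 : RegularityStructure.{u₁} n) where
  Γ : Pt n → Pt n → 𝒯.G
  Pi : Pt n → 𝒯.Space →ₗ[ℝ] (𝓢(Pt n, ℝ) →L[ℝ] ℝ)
  Γ_mul : ∀ x y z, Γ x y * Γ y z = Γ x z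
  Pi_Γ : ∀ x y a, Pi x ((Γ x y : 𝒯.Space ≃ₗ[ℝ] 𝒯.Space) a) = Pi y a
  Pi_bound : ∀ γ : ℝ, 0 < γ → ∀ 𝔎 : Set (Pt n), IsCompact 𝔎 → ∃ C : ℝ,
    ∀ x ∈ 𝔎, ∀ δ : ℝ, 0 < δ → δ ≤ 1 → ∀ ψ, IsScaledBump 𝒯.order x δ ψ →
      ∀ l < γ, ∀ a : 𝒯.T l, |pairS (Pi x (𝒯.incl l a)) ψ| ≤ C * ‖a‖ * δ ^ l
  Γ_bound : ∀ γ : ℝ, 0 < γ → ∀ 𝔎 : Set (Pt n), IsCompact 𝔎 → ∃ C : ℝ,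
    ∀ x ∈ 𝔎, ∀ y ∈ 𝔎, ∀ l < γ, ∀ m < l, ∀ a : 𝒯.T l,
      ‖((Γ x y : 𝒯.Space ≃ₗ[ℝ] 𝒯.Space) (𝒯.incl l a)) m‖ ≤ C * ‖a‖ * sdist x y ^ (l - m)
  Pi_poly : ∀ x (k : MIdx n) (φ : 𝓢(Pt n, ℝ)),
    Pi x (𝒯.mono k) φ = ∫ y, monom k (y - x) * φ y

/-- `Γ_{xy}` as an operator on `T`. -/
abbrev Model.op {𝒯 : RegularityStructure.{u₁} n} (M : Model 𝒯) (x y : Pt n) :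
    𝒯.Space ≃ₗ[ℝ] 𝒯.Space := (M.Γ x y : 𝒯.Space ≃ₗ[ℝ] 𝒯.Space)

/-- Convergence of models as `ε → 0`: `‖Π^ε - Π^0‖_{γ;𝔎} → 0` and `‖Γ^ε - Γ^0‖_{γ;𝔎} → 0` for all
`γ > 0` and all compact `𝔎`. -/
def ModelsConverge {𝒯 : RegularityStructure.{u₁} n} (M : unitInterval → Model 𝒯) : Prop :=
  ∀ γ : ℝ, 0 < γ → ∀ 𝔎 : Set (Pt n), IsCompact 𝔎 → ∀ κ : ℝ, 0 < κ → ∃ ρ : ℝ, 0 < ρ ∧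
    ∀ ε : unitInterval, (ε : ℝ) < ρ →
      (∀ x ∈ 𝔎, ∀ δ : ℝ, 0 < δ → δ ≤ 1 → ∀ ψ, IsScaledBump 𝒯.order x δ ψ →
        ∀ l < γ, ∀ a : 𝒯.T l,
          |pairS ((M ε).Pi x (𝒯.incl l a)) ψ - pairS ((M 0).Pi x (𝒯.incl l a)) ψ|
            ≤ κ * ‖a‖ * δ ^ l) ∧
      (∀ x ∈ 𝔎, ∀ y ∈ 𝔎, ∀ l < γ, ∀ m < l, ∀ a : 𝒯.T l,
        ‖((M ε).op x y (𝒯.incl l a) - (M 0).op x y (𝒯.incl l a)) m‖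
          ≤ κ * ‖a‖ * sdist x y ^ (l - m))

/-! ### The boundary, weights, weighted spaces -/

/-- The initial hyperplane `P₀`. -/
def P0 (n : ℕ) : Set (Pt n) := {z | z 0 = 0}

/-- The lateral boundary `P₁ = ℝ × ∂D`. -/
def P1 (D : Set (Fin n → ℝ)) : Set (Pt n) := {z | Fin.tail z ∈ frontier D}

/-- `P = P₀ ∪ P₁`. -/
def PP (D : Set (Fin n → ℝ)) : Set (Pt n) := P0 n ∪ P1 D

/-- `1 ∧ d_𝔰(x, S)`. -/
def bdist (S : Set (Pt n)) (x : Pt n) : ℝ := min 1 (sInf (sdist x '' S))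

/-- `|x|_{P₀}`. -/
def b0 (x : Pt n) : ℝ := bdist (P0 n) x

/-- `|x|_{P₁}`. -/
def b1 (D : Set (Fin n → ℝ)) (x : Pt n) : ℝ := bdist (P1 D) x

/-- `(0, τ] × D`, that is `([0,τ] × D) \ P` for open `D`. -/
def cyl (D : Set (Fin n → ℝ)) (τ : ℝ) : Set (Pt n) :=
  {z | 0 < z 0 ∧ z 0 ≤ τ ∧ Fin.tail z ∈ D}

/-- A weight `w = (η, σ, μ)`: exponents at `P₀`, at `P₁` and at `P₀ ∩ P₁`. -/
structure Weight where
  η : ℝ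
  σ : ℝ
  μ : ℝ

/-- The set `𝔎_P` of pairs of points. -/
def pairsP (D : Set (Fin n → ℝ)) (𝔎 : Set (Pt n)) : Set (Pt n × Pt n) :=
  {p | p.1 ∈ 𝔎 \ PP D ∧ p.2 ∈ 𝔎 \ PP D ∧ p.1 ≠ p.2 ∧
    2 * sdist p.1 p.2 ≤ min (min (b0 p.1) (b0 p.2)) (min (b1 D p.1) (b1 D p.2))}

/-- The denominator of the increment term of the norm of `𝒟_P^{γ,w}`. -/
def incrWeight (D : Set (Fin n → ℝ)) (γ : ℝ) (w : Weight) (l : ℝ) (x y : Pt n) : ℝ :=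
  sdist x y ^ (γ - l) * min (b0 x) (b0 y) ^ (w.η - γ) * min (b1 D x) (b1 D y) ^ (w.σ - γ) *
    max (min (b0 x) (b0 y)) (min (b1 D x) (b1 D y)) ^ (w.μ - w.η - w.σ + γ)

/-- The expression defining the norm of `𝒟_P^{γ,w}` over `𝔎`, applied to increments `I x y` and values
`f x`. -/
def weightedSup {𝒯 : RegularityStructure.{u₁} n} (D : Set (Fin n → ℝ)) (γ : ℝ) (w : Weight)
    (𝔎 : Set (Pt n)) (I : Pt n → Pt n → 𝒯.Space) (f : Pt n → 𝒯.Space) : ℝ≥0∞ :=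
  (⨆ p ∈ pairsP D 𝔎, ⨆ l : ℝ, ⨆ _ : l < γ,
      ENNReal.ofReal (‖(I p.1 p.2) l‖ / incrWeight D γ w l p.1 p.2)) +
  (⨆ x ∈ {x | x ∈ 𝔎 ∧ 0 < b0 x ∧ b0 x ≤ b1 D x}, ⨆ l : ℝ, ⨆ _ : l < γ,
      ENNReal.ofReal (‖(f x) l‖ /
        (b1 D x ^ (w.μ - l) * (b0 x / b1 D x) ^ (min (w.η - l) 0)))) +
  (⨆ x ∈ {x | x ∈ 𝔎 ∧ 0 < b1 D x ∧ b1 D x ≤ b0 x}, ⨆ l : ℝ, ⨆ _ : l < γ,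
      ENNReal.ofReal (‖(f x) l‖ /
        (b0 x ^ (w.μ - l) * (b1 D x / b0 x) ^ (min (w.σ - l) 0))))

/-- The norm `|||f|||_{γ,w;D_τ}`. -/
def modNorm {𝒯 : RegularityStructure.{u₁} n} (M : Model 𝒯) (D : Set (Fin n → ℝ)) (γ : ℝ)
    (w : Weight) (τ : ℝ) (f : Pt n → 𝒯.Space) : ℝ≥0∞ :=
  weightedSup D γ w (cyl D τ) (fun x y => f x - M.op x y (f y)) f

/-- The distance `|||f;g|||_{γ,w;D_τ}` between modelled distributions for two models. -/
def modDist {𝒯 : RegularityStructure.{u₁} n} (M M' : Model 𝒯) (D : Set (Fin n → ℝ)) (γ : ℝ)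
    (w : Weight) (τ : ℝ) (f g : Pt n → 𝒯.Space) : ℝ≥0∞ :=
  weightedSup D γ w (cyl D τ)
    (fun x y => f x - g x - M.op x y (f y) + M'.op x y (g y)) (fun x => f x - g x)

/-- `f` belongs to `𝒟_P^{γ,w}(V, Γ)` up to time `τ`. Functions on `([0,τ] × D) \ P` are extended by `0`
(so that they are not changed by multiplication with the indicator `𝐑^D_+`). -/
structure MemD {𝒯 : RegularityStructure.{u₁} n} (M : Model 𝒯) (D : Set (Fin n → ℝ)) (γ : ℝ)
    (w : Weight) {α : ℝ} (V : Sector 𝒯 α) (τ : ℝ) (f : Pt n → 𝒯.Space) : Prop where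
  support : ∀ z, z ∉ cyl D τ → f z = 0
  mem : ∀ z, f z ∈ V.toSubmodule
  trunc : ∀ z l, γ ≤ l → (f z) l = 0
  finite : modNorm M D γ w τ f < ⊤

/-- The norm `‖u‖_{a;τ}` of the weighted Hölder space `𝒞_P^a`, over test functions supported in
`(-∞, τ] × ℝ^{d-1}`; here `a = (a₀, a₁, a_∩)`. -/
def holderNorm (D : Set (Fin n → ℝ)) (a : Weight) (τ : ℝ) (u : TestUpTo n τ →ₗ[ℝ] ℝ) : ℝ≥0∞ :=
  max
    (⨆ (x : Pt n) (r : ℝ) (ψ : TestUpTo n τ) (_ : b0 x ≤ 2 * b1 D x) (_ : 0 < r) (_ : r ≤ 1)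
      (_ : 2 * r ≤ b1 D x) (_ : IsScaledBump ⌈-a.η + 1⌉₊ x r (ψ : Pt n → ℝ)),
      ENNReal.ofReal (|u ψ| / (b1 D x ^ (a.μ - a.η) * r ^ a.η)))
    (⨆ (x : Pt n) (r : ℝ) (ψ : TestUpTo n τ) (_ : b1 D x ≤ 2 * b0 x) (_ : 0 < r) (_ : r ≤ 1)
      (_ : 2 * r ≤ b0 x) (_ : IsScaledBump ⌈-a.σ + 1⌉₊ x r (ψ : Pt n → ℝ)),
      ENNReal.ofReal (|u ψ| / (b0 x ^ (a.μ - a.σ) * r ^ a.σ)))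

/-- `u` belongs to `𝒞_P^a` up to time `τ`, for `a` with nonpositive entries: it is of class
`𝒞^{min(a₀,a₁,a_∩)}`, vanishes outside of `ℝ₊ × D`, and has finite weighted norm. -/
structure MemHolder (D : Set (Fin n → ℝ)) (a : Weight) (τ : ℝ) (u : TestUpTo n τ →ₗ[ℝ] ℝ) :
    Prop where
  holder : ∀ 𝔎 : Set (Pt n), IsCompact 𝔎 → ∃ C : ℝ, ∀ x ∈ 𝔎, ∀ r : ℝ, 0 < r → r ≤ 1 →
    ∀ ψ : TestUpTo n τ,
      IsScaledBump (⌈-(min (min a.η a.σ) a.μ)⌉₊ + 1) x r (ψ : Pt n → ℝ) →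
        |u ψ| ≤ C * r ^ (min (min a.η a.σ) a.μ)
  support : ∀ ψ : TestUpTo n τ,
    Disjoint (tsupport (ψ : Pt n → ℝ)) {z | 0 ≤ z 0 ∧ Fin.tail z ∈ closure D} → u ψ = 0
  finite : holderNorm D a τ u < ⊤

/-- `u` agrees, on test functions supported in `(-∞,τ] × ℝ^{d-1}` and away from `P`, with the local
reconstruction of the modelled distribution `f` of order `γ > 0` in a sector of regularity `α`:
the local reconstruction is the only distribution off `P` that satisfies the bound below. -/
def IsLocalReconstruction {𝒯 : RegularityStructure.{u₁} n} (M : Model 𝒯) (D : Set (Fin n → ℝ))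
    (γ α τ : ℝ) (f : Pt n → 𝒯.Space) (u : TestUpTo n τ →ₗ[ℝ] ℝ) : Prop :=
  ∀ 𝔎 : Set (Pt n), IsCompact 𝔎 → 𝔎 ⊆ {z | z 0 < τ} \ PP D → ∃ C : ℝ, ∀ x ∈ 𝔎,
    ∀ r : ℝ, 0 < r → r ≤ 1 → 4 * r ≤ min (b0 x) (b1 D x) →
      ∀ ψ : TestUpTo n τ, IsScaledBump ⌈-α + 1⌉₊ x r (ψ : Pt n → ℝ) →
        |u ψ - pairS (M.Pi x (f x)) ψ| ≤ C * r ^ γ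

/-! ### Kernels and integration -/

/-- A kernel `K = ∑ₙ Kₙ` in the class `𝒦_β` (on `ℝ^{n+1}`), given with its decomposition. -/
structure SingularKernel (n : ℕ) (β : ℝ) where
  piece : ℕ → Pt n → Pt n → ℝ
  smooth : ∀ m, ContDiff ℝ ∞ (fun p : Pt n × Pt n => piece m p.1 p.2)
  support : ∀ m x y, piece m x y ≠ 0 → sdist x y ≤ (2 : ℝ) ^ (-(m : ℝ))
  bound : ∀ k l : MIdx n, ∃ C : ℝ, ∀ m x y,
    |mderiv k (fun x' => D2 l (piece m) x' y) x| ≤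
      C * (2 : ℝ) ^ ((m : ℝ) * ((scalingSum n : ℝ) + (sdeg (k + l) : ℝ) - β))
  moment : ∀ k l : MIdx n, ∃ C : ℝ, ∀ m y,
    |∫ x, monom l (x - y) * D1 k (piece m) x y| ≤ C * (2 : ℝ) ^ (-β * (m : ℝ)) ∧
    |∫ x, monom l (x - y) * D2 k (piece m) x y| ≤ C * (2 : ℝ) ^ (-β * (m : ℝ))
  /-- the pieces annihilate polynomials of degree at most `annih` -/
  annih : ℝ
  annih_pos : 0 < annih
  annihilates : ∀ m x (k : MIdx n), (sdeg k : ℝ) ≤ annih → ∫ y, piece m x y * monom k y = 0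

/-- `K` is non-anticipative. -/
def SingularKernel.NonAnticipative {β : ℝ} (K : SingularKernel n β) : Prop :=
  ∀ z z' : Pt n, z 0 < z' 0 → ∑' m, K.piece m z z' = 0

/-- A kernel `Z = ∑ₙ Zₙ` in the class `𝒵_{β,P}`, given with its decomposition. -/
structure BoundaryKernel (D : Set (Fin n → ℝ)) (β : ℝ) where
  piece : ℕ → Pt n → Pt n → ℝ
  smooth : ∀ m, ContDiffOn ℝ ∞ (fun p : Pt n × Pt n => piece m p.1 p.2) ((PP D)ᶜ ×ˢ Set.univ)
  support : ∃ C : ℝ, ∀ m z z', z ∉ PP D → piece m z z' ≠ 0 →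
    b1 D z + b1 D z' + |z 0 - z' 0| ^ ((1 : ℝ) / 2) ≤ C * (2 : ℝ) ^ (-(m : ℝ))
  /-- the sections are compactly supported, so that distributions can be tested against them -/
  spatial_support : ∀ m, ∃ C : ℝ, ∀ z z', z ∉ PP D → piece m z z' ≠ 0 → ‖Fin.tail z'‖ ≤ C
  bound : ∀ k l : MIdx n, ∃ C : ℝ, ∀ m z z', z ∉ PP D →
    |mderiv k (fun x' => D2 l (piece m) x' z') z| ≤
      C * (2 : ℝ) ^ ((m : ℝ) * ((scalingSum n : ℝ) + (sdeg (k + l) : ℝ) - β))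

/-- `Z` is non-anticipative. -/
def BoundaryKernel.NonAnticipative {D : Set (Fin n → ℝ)} {β : ℝ} (Z : BoundaryKernel D β) : Prop :=
  ∀ z z' : Pt n, z ∉ PP D → z' ∉ PP D → z 0 < z' 0 → ∑' m, Z.piece m z z' = 0

/-- `I` is an abstract integration map of order `β` on the sector `U` (only its values on `U` matter). -/
structure IsAbstractIntegration {𝒯 : RegularityStructure.{u₁} n} {α : ℝ} (U : Sector 𝒯 α) (β : ℝ)
    (I : 𝒯.Space →ₗ[ℝ] 𝒯.Space) : Prop where
  degree : ∀ (δ : ℝ) (a : 𝒯.T δ), a ∈ U.comp δ → ∀ δ', δ' ≠ δ + β → (I (𝒯.incl δ a)) δ' = 0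
  poly : ∀ a ∈ U.toSubmodule, a ∈ 𝒯.poly → I a = 0
  commute : ∀ a ∈ U.toSubmodule, ∀ Γ ∈ 𝒯.G, I (Γ a) - Γ (I a) ∈ 𝒯.poly

open Classical in
/-- `𝒥(x) a = ∑_α ∑_{|k|_𝔰 < α + β} X^k/k! ∑ₙ (Π_x a_α)(D₁^k Kₙ(x,·))`. -/
def liftJ {𝒯 : RegularityStructure.{u₁} n} (M : Model 𝒯) {β : ℝ} (K : SingularKernel n β)
    (x : Pt n) (a : 𝒯.Space) : 𝒯.Space :=
  ∑ α ∈ DFinsupp.support a, ∑ k ∈ below (α + β),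
    ((mfact k)⁻¹ * ∑' m, pairS (M.Pi x (𝒯.incl α (a α))) (D1 k (K.piece m) x)) • 𝒯.mono k

/-- `(𝒩_γ^ζ f)(x) = ∑_{|k|_𝔰 < γ + β} X^k/k! ∑ₙ (ζ - Π_x f(x))(D₁^k Kₙ(x,·))`. -/
def liftN {𝒯 : RegularityStructure.{u₁} n} (M : Model 𝒯) {β : ℝ} (K : SingularKernel n β)
    (γ : ℝ) (ζ : TestFn n →ₗ[ℝ] ℝ) (f : Pt n → 𝒯.Space) (x : Pt n) : 𝒯.Space :=
  ∑ k ∈ below (γ + β),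
    ((mfact k)⁻¹ * ∑' m, (pair ζ (D1 k (K.piece m) x) - pairS (M.Pi x (f x)) (D1 k (K.piece m) x)))
      • 𝒯.mono k

/-- `(𝒦_γ^ζ f)(x) = I f(x) + 𝒥(x) f(x) + (𝒩_γ^ζ f)(x)`. -/
def liftK {𝒯 : RegularityStructure.{u₁} n} (M : Model 𝒯) {β : ℝ} (K : SingularKernel n β)
    (I : 𝒯.Space →ₗ[ℝ] 𝒯.Space) (γ : ℝ) (ζ : TestFn n →ₗ[ℝ] ℝ) (f : Pt n → 𝒯.Space) (x : Pt n) :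
    𝒯.Space :=
  I (f x) + liftJ M K x (f x) + liftN M K γ ζ f x

/-- `(Z_γ ζ)(x)`: the Taylor lift, up to degree `γ + β`, of `z ↦ ∑ₙ ⟨ζ, Zₙ(z,·)⟩`. -/
def liftZ (𝒯 : RegularityStructure.{u₁} n) {D : Set (Fin n → ℝ)} {β : ℝ} (Z : BoundaryKernel D β)
    (γ : ℝ) (ζ : TestFn n →ₗ[ℝ] ℝ) (x : Pt n) : 𝒯.Space :=
  ∑ k ∈ below (γ + β), ((mfact k)⁻¹ * ∑' m, pair ζ (D1 k (Z.piece m) x)) • 𝒯.mono k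

/-- The model realises `K` for `I` on the sector `U`: for homogeneous `a ∈ U`,
`Π_x I a = ∫ K(·,z) (Π_x a)(dz) - Π_x 𝒥(x) a` as distributions. -/
def Realises {𝒯 : RegularityStructure.{u₁} n} (M : Model 𝒯) {β : ℝ} (K : SingularKernel n β)
    {α : ℝ} (U : Sector 𝒯 α) (I : 𝒯.Space →ₗ[ℝ] 𝒯.Space) : Prop :=
  ∀ (δ : ℝ) (a : 𝒯.T δ), a ∈ U.comp δ → ∀ x, ∀ φ ∈ TestFn n,
    HasSum (fun m => pairS (M.Pi x (𝒯.incl δ a)) (fun z => ∫ y, φ y * K.piece m y z))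
      (pairS (M.Pi x (I (𝒯.incl δ a) + liftJ M K x (𝒯.incl δ a))) φ)

/-! ### Time-indexed spaces -/

/-- Positive times. -/
abbrev Time := Set.Ioi (0 : ℝ)

instance : One Time := ⟨⟨1, Set.mem_Ioi.mpr one_pos⟩⟩

/-- A time-indexed space: Banach spaces `V_τ`, `τ > 0`, with linear contractions
`V_τ → V_{τ'}` for `τ' ≤ τ` that compose (and are the identity for `τ' = τ`). -/
structure TimeIndexedSpace where
  X : Time → Type u₁
  [grp : ∀ τ, NormedAddCommGroup (X τ)]
  [mod : ∀ τ, NormedSpace ℝ (X τ)]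
  [complete : ∀ τ, CompleteSpace (X τ)]
  res : ∀ {τ' τ : Time}, τ' ≤ τ → X τ →ₗ[ℝ] X τ'
  norm_res_le : ∀ {τ' τ : Time} (h : τ' ≤ τ) (v : X τ), ‖res h v‖ ≤ ‖v‖
  res_self : ∀ {τ : Time} (v : X τ), res (le_refl τ) v = v
  res_res : ∀ {τ'' τ' τ : Time} (h : τ'' ≤ τ') (h' : τ' ≤ τ) (v : X τ),
    res h (res h' v) = res (h.trans h') v

attribute [instance] TimeIndexedSpace.grp TimeIndexedSpace.mod TimeIndexedSpace.complete

/-- Elements of the Fréchet space of a time-indexed space: consistent families. -/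
def TimeIndexedSpace.Global (V : TimeIndexedSpace.{u₁}) : Type u₁ :=
  {v : ∀ τ, V.X τ // ∀ (τ' τ : Time) (h : τ' ≤ τ), V.res h (v τ) = v τ'}

/-- An adapted map. -/
structure AdaptedMap (V : TimeIndexedSpace.{u₁}) (W : TimeIndexedSpace.{u₂}) where
  toFun : ∀ τ, V.X τ → W.X τ
  res_comm : ∀ {τ' τ : Time} (h : τ' ≤ τ) (v : V.X τ),
    W.res h (toFun τ v) = toFun τ' (V.res h v)

/-- An adapted linear map: the norms are bounded over bounded sets of times. -/
structure AdaptedLinearMap (V : TimeIndexedSpace.{u₁}) (W : TimeIndexedSpace.{u₂}) where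
  toFun : ∀ τ, V.X τ →ₗ[ℝ] W.X τ
  res_comm : ∀ {τ' τ : Time} (h : τ' ≤ τ) (v : V.X τ),
    W.res h (toFun τ v) = toFun τ' (V.res h v)
  bounded : ∀ T : Time, ∃ C : ℝ, ∀ τ ≤ T, ∀ v : V.X τ, ‖toFun τ v‖ ≤ C * ‖v‖

/-! ### The setting of the fixed point problem -/

/-- The data and the standing assumptions of the abstract fixed point problem on `ℝ^{n+1}`. -/
structure FixedPointSetting (n : ℕ) where
  one_le : 1 ≤ n
  /-- the regularity structure, the exponents, the sector `V` -/
  𝒯 : RegularityStructure.{u₁} n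
  γ : ℝ
  γ₀ : ℝ
  γ_pos : 0 < γ
  γ₀_pos : 0 < γ₀
  γ_lt : γ < γ₀ + 2
  w : Weight
  α : ℝ
  V : Sector 𝒯 α
  poly_le : 𝒯.poly ≤ V.toSubmodule
  /-- the spatial domain -/
  D : Set (Fin n → ℝ)
  D_open : IsOpen D
  D_connected : IsConnected D
  D_bounded : Bornology.IsBounded D
  /-- abstract integration (on a sector `U`) and the kernels -/
  αU : ℝ
  U : Sector 𝒯 αU
  I : 𝒯.Space →ₗ[ℝ] 𝒯.Space
  isIntegration : IsAbstractIntegration U 2 I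
  K : SingularKernel n 2
  K_causal : K.NonAnticipative
  Z : BoundaryKernel D 2
  Z_causal : Z.NonAnticipative
  /-- admissible models, converging as `ε → 0` -/
  model : unitInterval → Model 𝒯
  realises : ∀ ε, Realises (model ε) K U I
  converge : ModelsConverge model
  /-- the spaces `𝒱_ε`, and the components of the right-hand side -/
  𝒱 : unitInterval → TimeIndexedSpace.{u₂}
  N : ℕ
  αs : Fin (N + 1) → ℝ
  Vs : ∀ i, Sector 𝒯 (αs i)
  Vs_le : ∀ i, (Vs i).toSubmodule ≤ U.toSubmodule
  I_Vs : ∀ i, ∀ a ∈ (Vs i).toSubmodule, I a ∈ V.toSubmodule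
  ws : Fin (N + 1) → Weight
  ws_nonpos : ∀ i, (ws i).η ≤ 0 ∧ (ws i).σ ≤ 0 ∧ (ws i).μ ≤ 0
  /-- the adapted linear maps `ι_ε` into `⨁ᵢ 𝒟_P^{γ₀,wᵢ}(Vᵢ, Γ^ε)` -/
  ι : ∀ ε τ, (𝒱 ε).X τ →ₗ[ℝ] (Fin (N + 1) → Pt n → 𝒯.Space)
  ι_mem : ∀ ε (τ : Time) v i, MemD (model ε) D γ₀ (ws i) (Vs i) τ (ι ε τ v i)
  ι_res : ∀ ε (τ' τ : Time) (h : τ' ≤ τ) (v : (𝒱 ε).X τ) i, ∀ z ∈ cyl D (τ' : ℝ),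
    ι ε τ' ((𝒱 ε).res h v) i z = ι ε τ v i z
  ι_bounded : ∀ ε (T : Time), ∃ C : ℝ≥0, ∀ τ ≤ T, ∀ v : (𝒱 ε).X τ,
    ∑ i, modNorm (model ε) D γ₀ (ws i) (τ : ℝ) (ι ε τ v i) ≤ C * ‖v‖ₑ
  /-- the adapted linear maps `R̂^ε` into `⨁ᵢ 𝒞_P^{wᵢ}` -/
  Rhat : ∀ ε (τ : Time), (𝒱 ε).X τ →ₗ[ℝ] (Fin (N + 1) → (TestUpTo n (τ : ℝ) →ₗ[ℝ] ℝ))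
  Rhat_mem : ∀ ε (τ : Time) v i, MemHolder D (ws i) (τ : ℝ) (Rhat ε τ v i)
  Rhat_res : ∀ ε (τ' τ : Time) (h : τ' ≤ τ) (v : (𝒱 ε).X τ) i
    (ψ' : TestUpTo n (τ' : ℝ)) (ψ : TestUpTo n (τ : ℝ)), (ψ' : Pt n → ℝ) = ψ →
      Rhat ε τ' ((𝒱 ε).res h v) i ψ' = Rhat ε τ v i ψ
  Rhat_bounded : ∀ ε (T : Time), ∃ C : ℝ≥0, ∀ τ ≤ T, ∀ v : (𝒱 ε).X τ,
    ∑ i, holderNorm D (ws i) (τ : ℝ) (Rhat ε τ v i) ≤ C * ‖v‖ₑ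
  /-- `R̂^ε v` extends the local reconstruction of `𝐑^D_+ ι_ε v` -/
  Rhat_local : ∀ ε (τ : Time) v i,
    IsLocalReconstruction (model ε) D γ₀ (αs i) (τ : ℝ) (ι ε τ v i) (Rhat ε τ v i)
  /-- the spaces `𝒲_ε` of modelled distributions in `𝒟_P^{γ,w}(V, Γ^ε)` -/
  𝒲 : unitInterval → TimeIndexedSpace.{u₃}
  real : ∀ ε τ, (𝒲 ε).X τ →ₗ[ℝ] (Pt n → 𝒯.Space)
  real_injective : ∀ ε τ, Function.Injective (real ε τ)
  real_mem : ∀ ε (τ : Time) u, MemD (model ε) D γ w V τ (real ε τ u)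
  real_res : ∀ ε (τ' τ : Time) (h : τ' ≤ τ) (u : (𝒲 ε).X τ), ∀ z ∈ cyl D (τ' : ℝ),
    real ε τ' ((𝒲 ε).res h u) z = real ε τ u z
  /-- the operator `𝒫^{(ε)} v = ∑ᵢ 𝒦^{(R̂^ε v)ᵢ}(𝐑^D_+ ι_ε v)ᵢ + Z (R̂^ε v)ᵢ`, with values in `𝒲_ε`
  (components of degree `γ` or more are dropped). At times before `τ` the formula does not depend on how
  `R̂^ε v` is extended to test functions that are not supported in `(-∞,τ] × ℝ^{d-1}`. -/
  P : ∀ ε, AdaptedLinearMap (𝒱 ε) (𝒲 ε)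
  P_eq : ∀ ε (τ : Time) (v : (𝒱 ε).X τ) (ζ : Fin (N + 1) → (TestFn n →ₗ[ℝ] ℝ)),
    (∀ i (ψ : TestUpTo n (τ : ℝ)), ζ i ⟨ψ, ψ.2.1⟩ = Rhat ε τ v i ψ) →
    ∀ z ∈ cyl D (τ : ℝ), z 0 < τ → ∀ l < γ,
      (real ε τ ((P ε).toFun τ v) z) l =
        (∑ i, (liftK (model ε) K I γ₀ (ζ i) (ι ε τ v i) z + liftZ 𝒯 Z γ₀ (ζ i) z)) l
  /-- the short-time bound -/
  θ : ℝ
  θ_pos : 0 < θ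
  P_short : ∃ C : ℝ, ∀ ε (τ : Time), τ ≤ 1 → ∀ v : (𝒱 ε).X τ,
    ‖(P ε).toFun τ v‖ ≤ C * (τ : ℝ) ^ θ * ‖v‖
  /-- the nonlinearities, adapted and locally Lipschitz, uniformly in `ε` -/
  F : ∀ ε, AdaptedMap (𝒲 ε) (𝒱 ε)
  F_lipschitz : ∀ (R : ℝ) (T : Time), ∃ L : ℝ, ∀ ε, ∀ τ ≤ T, ∀ f g : (𝒲 ε).X τ,
    ‖f‖ ≤ R → ‖g‖ ≤ R → ‖(F ε).toFun τ f - (F ε).toFun τ g‖ ≤ L * ‖f - g‖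
  F_zero : ∃ B : ℝ, ∀ ε, ‖(F ε).toFun 1 0‖ ≤ B
  /-- the 'distances' on `𝒲_ε × 𝒲_0` -/
  dist : ∀ ε τ, (𝒲 ε).X τ → (𝒲 0).X τ → ℝ
  dist_nonneg : ∀ ε τ f g, 0 ≤ dist ε τ f g
  dist_add_le : ∀ ε τ f f' g g', dist ε τ (f + f') (g + g') ≤ dist ε τ f g + dist ε τ f' g'
  P_compatible : ∀ R : ℝ, ∃ C : ℝ≥0, ∀ κ : ℝ≥0, 0 < κ → ∃ ρ : ℝ, 0 < ρ ∧
    ∀ ε : unitInterval, (ε : ℝ) < ρ → ∀ τ : Time, τ ≤ 1 →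
      ∀ (f : (𝒱 ε).X τ) (g : (𝒱 0).X τ), ‖f‖ ≤ R → ‖g‖ ≤ R →
        ENNReal.ofReal ((τ : ℝ) ^ (-θ) * dist ε τ ((P ε).toFun τ f) ((P 0).toFun τ g)) ≤
          C * (∑ i, modDist (model ε) (model 0) D γ₀ (ws i) (τ : ℝ) (ι ε τ f i) (ι 0 τ g i) +
            ∑ i, holderNorm D (ws i) (τ : ℝ) (Rhat ε τ f i - Rhat 0 τ g i)) + κ
  F_compatible : ∀ R : ℝ, ∃ C : ℝ≥0, ∀ κ : ℝ≥0, 0 < κ → ∃ ρ : ℝ, 0 < ρ ∧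
    ∀ ε : unitInterval, (ε : ℝ) < ρ → ∀ τ : Time, τ ≤ 1 →
      ∀ (f : (𝒲 ε).X τ) (g : (𝒲 0).X τ), ‖f‖ ≤ R → ‖g‖ ≤ R →
        ∑ i, modDist (model ε) (model 0) D γ₀ (ws i) (τ : ℝ)
            (ι ε τ ((F ε).toFun τ f) i) (ι 0 τ ((F 0).toFun τ g) i) +
          ∑ i, holderNorm D (ws i) (τ : ℝ)
            (Rhat ε τ ((F ε).toFun τ f) i - Rhat 0 τ ((F 0).toFun τ g) i) ≤
          C * ENNReal.ofReal (dist ε τ f g) + κ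

namespace FixedPointSetting

/-- The data `v ∈ 𝒲_ε` with `2 ‖v‖_{𝒲_ε;1} < R`. -/
def Data (S : FixedPointSetting.{u₁, u₂, u₃} n) (R : ℝ) (ε : unitInterval) : Type u₃ :=
  {v : (S.𝒲 ε).Global // 2 * ‖v.1 1‖ < R}

/-- `u` solves `u = 𝒫^{(ε)} F_ε(u) + v` on `(0,τ)`. -/
def IsSolution (S : FixedPointSetting.{u₁, u₂, u₃} n) (ε : unitInterval) (τ : Time)
    (v : (S.𝒲 ε).Global) (u : (S.𝒲 ε).X τ) : Prop :=
  u = (S.P ε).toFun τ ((S.F ε).toFun τ u) + v.1 τ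

end FixedPointSetting

end SingularSPDE

end

namespace SingularSPDE

universe u₁ u₂ u₃

variable {n : ℕ}

namespace FixedPointSetting

/-! ### Short-time estimates for `𝒫^{(ε)} F_ε`, uniform in `ε` -/

variable (S : FixedPointSetting.{u₁, u₂, u₃} n)

/-! The theorem is a Banach fixed point argument, uniform in `ε`, followed by a continuation
argument in time. The linear operator `𝒫^{(ε)}` gains a factor `τ^θ` and `F_ε` is Lipschitz on
balls. So on the ball of radius `R` the map `𝒫^{(ε)} F_ε` is bounded by a multiple of `τ^θ`
(`exists_PF_bound`) and has a Lipschitz constant of the same order (`exists_PF_lipschitz`). For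
short times it sends this ball into the ball of radius `R / 2` and is a `1/2`-contraction there.
Adding `v`, whose norm is less than `R / 2`, yields a unique fixed point in the ball.

Uniqueness beyond the ball rests on causality: solutions restrict to solutions (`IsSolution.res`). A
solution `u` of any size obeys the bound for the ball of radius `‖u‖`, so it enters the ball of
radius `R` after restriction to a short enough time (`IsSolution.exists_norm_res_le`), where it must
agree with the fixed point. If its norm is continuous in time, it cannot leave the ball later: at
norm exactly `R` the equation would force a norm strictly below `R` (`IsSolution.norm_lt`).

For continuity at `ε = 0`, composing the two compatibility assumptions bounds the distance between
the images under `𝒫F` by `A τ^θ` times the distance `d` between the solutions, up to `o(1)`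
(`exists_PF_dist_le`). For short times the first term is at most `d / 2` and is absorbed on the
left. Only nonnegativity and subadditivity of the 'distance' are needed. -/

/-- The nonlinearities are bounded on balls, uniformly in `ε` and in short times. -/
lemma exists_F_bound (R : ℝ) : ∃ B : ℝ, 0 ≤ B ∧ ∀ ε, ∀ τ : Time, τ ≤ 1 →
    ∀ u : (S.𝒲 ε).X τ, ‖u‖ ≤ R → ‖(S.F ε).toFun τ u‖ ≤ B := by
  obtain ⟨L, hL⟩ := S.F_lipschitz R 1
  obtain ⟨B, hB⟩ := S.F_zero
  refine ⟨|L| * |R| + |B|, by positivity, fun ε τ hτ u hu => ?_⟩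
  have hR : 0 ≤ R := (norm_nonneg u).trans hu
  have h0 : ‖(S.F ε).toFun τ 0‖ ≤ |B| := by
    -- `F_zero` speaks of time `1` only. Since `F_ε` is adapted, its value at `0` at time `τ` is the
    -- restriction of its value at `0` at time `1`, and restrictions are contractions.
    have h := (S.F ε).res_comm hτ 0
    rw [map_zero] at h
    rw [← h]
    exact ((S.𝒱 ε).norm_res_le hτ _).trans ((hB ε).trans (le_abs_self B))
  have h1 : ‖(S.F ε).toFun τ u - (S.F ε).toFun τ 0‖ ≤ |L| * |R| := by
    refine (hL ε τ hτ u 0 hu (by simpa using hR)).trans ?_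
    rw [sub_zero]
    exact mul_le_mul (le_abs_self L) (hu.trans (le_abs_self R)) (norm_nonneg u) (abs_nonneg L)
  calc ‖(S.F ε).toFun τ u‖
      = ‖((S.F ε).toFun τ u - (S.F ε).toFun τ 0) + (S.F ε).toFun τ 0‖ := by rw [sub_add_cancel]
    _ ≤ |L| * |R| + |B| := (norm_add_le _ _).trans (add_le_add h1 h0)

/-- On balls, `𝒫^{(ε)} F_ε` is of order `τ^θ`. -/
lemma exists_PF_bound (R : ℝ) : ∃ A : ℝ, 0 ≤ A ∧ ∀ ε, ∀ τ : Time, τ ≤ 1 →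
    ∀ u : (S.𝒲 ε).X τ, ‖u‖ ≤ R →
      ‖(S.P ε).toFun τ ((S.F ε).toFun τ u)‖ ≤ A * (τ : ℝ) ^ S.θ := by
  obtain ⟨B, hB0, hB⟩ := S.exists_F_bound R
  obtain ⟨C, hC⟩ := S.P_short
  refine ⟨|C| * B, by positivity, fun ε τ hτ u hu => ?_⟩
  have hθ : 0 ≤ (τ : ℝ) ^ S.θ := Real.rpow_nonneg (le_of_lt τ.2) _
  calc ‖(S.P ε).toFun τ ((S.F ε).toFun τ u)‖
      ≤ C * (τ : ℝ) ^ S.θ * ‖(S.F ε).toFun τ u‖ := hC ε τ hτ _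
    _ ≤ |C| * (τ : ℝ) ^ S.θ * B := by
        gcongr
        · exact le_abs_self C
        · exact hB ε τ hτ u hu
    _ = |C| * B * (τ : ℝ) ^ S.θ := by ring

/-- On balls, `𝒫^{(ε)} F_ε` has a Lipschitz constant of order `τ^θ`. -/
lemma exists_PF_lipschitz (R : ℝ) : ∃ A : ℝ, 0 ≤ A ∧ ∀ ε, ∀ τ : Time, τ ≤ 1 →
    ∀ u u' : (S.𝒲 ε).X τ, ‖u‖ ≤ R → ‖u'‖ ≤ R →
      ‖(S.P ε).toFun τ ((S.F ε).toFun τ u) - (S.P ε).toFun τ ((S.F ε).toFun τ u')‖ ≤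
        A * (τ : ℝ) ^ S.θ * ‖u - u'‖ := by
  obtain ⟨L, hL⟩ := S.F_lipschitz R 1
  obtain ⟨C, hC⟩ := S.P_short
  refine ⟨|C| * |L|, by positivity, fun ε τ hτ u u' hu hu' => ?_⟩
  have hθ : 0 ≤ (τ : ℝ) ^ S.θ := Real.rpow_nonneg (le_of_lt τ.2) _
  rw [← map_sub]
  calc ‖(S.P ε).toFun τ ((S.F ε).toFun τ u - (S.F ε).toFun τ u')‖
      ≤ C * (τ : ℝ) ^ S.θ * ‖(S.F ε).toFun τ u - (S.F ε).toFun τ u'‖ := hC ε τ hτ _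
    _ ≤ |C| * (τ : ℝ) ^ S.θ * (|L| * ‖u - u'‖) := by
        gcongr
        · exact le_abs_self C
        · exact (hL ε τ hτ u u' hu hu').trans
            (mul_le_mul_of_nonneg_right (le_abs_self L) (norm_nonneg _))
    _ = |C| * |L| * (τ : ℝ) ^ S.θ * ‖u - u'‖ := by ring

/-- The distance between `𝒫^{(ε)} F_ε(u)` and `𝒫^{(0)} F_0(u')` is controlled, up to `o(1)`, by
`τ^θ` times the distance between `u` and `u'`. -/
lemma exists_PF_dist_le (R : ℝ) : ∃ A : ℝ, 0 ≤ A ∧ ∀ κ : ℝ, 0 < κ → ∃ ρ : ℝ, 0 < ρ ∧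
    ∀ ε : unitInterval, (ε : ℝ) < ρ → ∀ τ : Time, τ ≤ 1 →
      ∀ (u : (S.𝒲 ε).X τ) (u' : (S.𝒲 0).X τ), ‖u‖ ≤ R → ‖u'‖ ≤ R →
        S.dist ε τ ((S.P ε).toFun τ ((S.F ε).toFun τ u))
            ((S.P 0).toFun τ ((S.F 0).toFun τ u')) ≤
          A * (τ : ℝ) ^ S.θ * S.dist ε τ u u' + κ := by
  obtain ⟨B, -, hB⟩ := S.exists_F_bound R
  -- `𝒫` is applied to `F_ε(u)` and `F_0(u')`, which lie in balls of radius `B`, uniformly in `ε`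
  -- and `τ`.
  obtain ⟨C₁, h₁⟩ := S.P_compatible B
  obtain ⟨C₂, h₂⟩ := S.F_compatible R
  refine ⟨C₁ * C₂, by positivity, fun κ hκ => ?_⟩
  -- The error `κ'` of `F_compatible` is multiplied by `C₁` and that of `P_compatible` is added to
  -- it: `C₁ (C₂ d + κ') + κ' = C₁ C₂ d + κ`.
  obtain ⟨κ', hκ', hκκ'⟩ : ∃ κ' : ℝ≥0, 0 < κ' ∧ (C₁ + 1) * (κ' : ℝ) = κ := by
    refine ⟨⟨κ / (C₁ + 1), by positivity⟩, ?_, ?_⟩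
    · exact NNReal.coe_pos.1 (show (0 : ℝ) < κ / (C₁ + 1) by positivity)
    · change ((C₁ : ℝ) + 1) * (κ / (C₁ + 1)) = κ
      field_simp
  obtain ⟨ρ₁, hρ₁, h₁⟩ := h₁ κ' hκ'
  obtain ⟨ρ₂, hρ₂, h₂⟩ := h₂ κ' hκ'
  refine ⟨min ρ₁ ρ₂, lt_min hρ₁ hρ₂, fun ε hε τ hτ u u' hu hu' => ?_⟩
  set d := S.dist ε τ u u'
  have hd : 0 ≤ d := S.dist_nonneg ε τ u u'
  have hτ0 : (0 : ℝ) < τ := τ.2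
  have hP := h₁ ε (hε.trans_le (min_le_left _ _)) τ hτ _ _ (hB ε τ hτ u hu) (hB 0 τ hτ u' hu')
  have hF := h₂ ε (hε.trans_le (min_le_right _ _)) τ hτ u u' hu hu'
  -- The intermediate norms take values in `[0, ∞]`. Once they are bounded by a finite quantity, the
  -- inequality can be read in `ℝ`.
  have hPF : ENNReal.ofReal ((τ : ℝ) ^ (-S.θ) * S.dist ε τ
      ((S.P ε).toFun τ ((S.F ε).toFun τ u)) ((S.P 0).toFun τ ((S.F 0).toFun τ u'))) ≤
      ENNReal.ofReal (C₁ * (C₂ * d + κ') + κ') := by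
    refine hP.trans ((add_le_add_left (mul_le_mul_right hF _) _).trans_eq ?_)
    rw [ENNReal.ofReal_add (by positivity) (by positivity), ENNReal.ofReal_mul (by positivity),
      ENNReal.ofReal_add (by positivity) (by positivity), ENNReal.ofReal_mul (by positivity)]
    simp only [ENNReal.ofReal_coe_nnreal]
    rfl
  rw [ENNReal.ofReal_le_ofReal_iff (by positivity), Real.rpow_neg hτ0.le,
    inv_mul_le_iff₀ (by positivity)] at hPF
  have hθ1 : (τ : ℝ) ^ S.θ ≤ 1 := Real.rpow_le_one hτ0.le hτ S.θ_pos.le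
  -- Multiplying out `τ^{-θ}` also puts `τ^θ` in front of the error, which is harmless for `τ ≤ 1`.
  have : (τ : ℝ) ^ S.θ * κ ≤ κ := mul_le_of_le_one_left hκ.le hθ1
  rw [← hκκ'] at this ⊢
  linarith [hPF]

/-- `A τ^θ` is small for short times. -/
lemma exists_time_mul_rpow_le {θ : ℝ} (hθ : 0 < θ) {A c : ℝ} (hA : 0 ≤ A) (hc : 0 < c) :
    ∃ T : Time, T ≤ 1 ∧ ∀ τ : Time, τ ≤ T → A * (τ : ℝ) ^ θ ≤ c := by
  -- `A + 1` in place of `A` covers the case `A = 0`.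
  have h1 : 0 < (c / (A + 1)) ^ θ⁻¹ := by positivity
  refine ⟨⟨min 1 ((c / (A + 1)) ^ θ⁻¹), lt_min one_pos h1⟩, ?_, fun τ hτ => ?_⟩
  · exact Subtype.coe_le_coe.1 (min_le_left _ _)
  · have hτ0 : (0 : ℝ) ≤ τ := le_of_lt τ.2
    have h2 : (τ : ℝ) ≤ (c / (A + 1)) ^ θ⁻¹ :=
      (Subtype.coe_le_coe.2 hτ).trans (min_le_right _ _)
    have h3 : (τ : ℝ) ^ θ ≤ c / (A + 1) := by
      calc (τ : ℝ) ^ θ ≤ ((c / (A + 1)) ^ θ⁻¹) ^ θ := Real.rpow_le_rpow hτ0 h2 hθ.le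
        _ = c / (A + 1) := Real.rpow_inv_rpow (by positivity) hθ.ne'
    calc A * (τ : ℝ) ^ θ ≤ (A + 1) * (c / (A + 1)) := by gcongr; linarith
      _ = c := by field_simp

/-! ### Solutions: restriction, existence, uniqueness, a priori bounds -/

variable {S}

/-- The restriction of a solution is a solution. -/
lemma IsSolution.res {ε : unitInterval} {s τ : Time} (h : s ≤ τ) {v : (S.𝒲 ε).Global}
    {u : (S.𝒲 ε).X τ} (hu : S.IsSolution ε τ v u) : S.IsSolution ε s v ((S.𝒲 ε).res h u) := by
  unfold IsSolution at hu ⊢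
  conv_lhs => rw [hu]
  rw [map_add, (S.P ε).res_comm, (S.F ε).res_comm, v.2]

/-- The norms of admissible data are less than `R / 2` up to time `1`. -/
lemma Data.two_mul_norm_lt {R : ℝ} {ε : unitInterval} (v : S.Data R ε) {τ : Time} (hτ : τ ≤ 1) :
    2 * ‖v.1.1 τ‖ < R := by
  have h := (S.𝒲 ε).norm_res_le hτ (v.1.1 1)
  rw [v.1.2] at h
  linarith [v.2]

/-- Solutions with norm at most `R` have norm less than `R` if `𝒫^{(ε)} F_ε` maps the ball of
radius `R` to the one of radius `R / 2`. -/
lemma IsSolution.norm_lt {R : ℝ} {ε : unitInterval} {v : S.Data R ε} {τ : Time} (hτ : τ ≤ 1)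
    (hb : ∀ u : (S.𝒲 ε).X τ, ‖u‖ ≤ R → ‖(S.P ε).toFun τ ((S.F ε).toFun τ u)‖ ≤ R / 2)
    {u : (S.𝒲 ε).X τ} (hu : S.IsSolution ε τ v.1 u) (huR : ‖u‖ ≤ R) : ‖u‖ < R := by
  have h1 : ‖u‖ ≤ ‖(S.P ε).toFun τ ((S.F ε).toFun τ u)‖ + ‖v.1.1 τ‖ := by
    conv_lhs => rw [show u = _ from hu]
    exact norm_add_le _ _
  -- The strictness comes from `2 ‖v‖ < R`.
  linarith [hb u huR, v.two_mul_norm_lt hτ]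

/-- Solutions in the ball of radius `R` are unique if `𝒫^{(ε)} F_ε` is a contraction there. -/
lemma IsSolution.eq_of_norm_le {R : ℝ} {ε : unitInterval} {v : (S.𝒲 ε).Global} {τ : Time}
    (hl : ∀ u u' : (S.𝒲 ε).X τ, ‖u‖ ≤ R → ‖u'‖ ≤ R →
      ‖(S.P ε).toFun τ ((S.F ε).toFun τ u) - (S.P ε).toFun τ ((S.F ε).toFun τ u')‖ ≤
        1 / 2 * ‖u - u'‖)
    {u u' : (S.𝒲 ε).X τ} (hu : S.IsSolution ε τ v u) (hu' : S.IsSolution ε τ v u')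
    (huR : ‖u‖ ≤ R) (huR' : ‖u'‖ ≤ R) : u = u' := by
  have h : u - u' =
      (S.P ε).toFun τ ((S.F ε).toFun τ u) - (S.P ε).toFun τ ((S.F ε).toFun τ u') := by
    conv_lhs => rw [show u = _ from hu, show u' = _ from hu']
    exact add_sub_add_right_eq_sub _ _ _
  have h1 := hl u u' huR huR'
  rw [← h] at h1
  exact sub_eq_zero.1 (norm_eq_zero.1 (le_antisymm (by linarith) (norm_nonneg _)))

/-- Existence of a solution in the ball of radius `R` if `𝒫^{(ε)} F_ε` maps it to the ball of radius
`R / 2` and is a contraction there. -/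
lemma exists_isSolution {R : ℝ} (hR : 0 < R) {ε : unitInterval} (v : S.Data R ε) {τ : Time}
    (hτ : τ ≤ 1)
    (hb : ∀ u : (S.𝒲 ε).X τ, ‖u‖ ≤ R → ‖(S.P ε).toFun τ ((S.F ε).toFun τ u)‖ ≤ R / 2)
    (hl : ∀ u u' : (S.𝒲 ε).X τ, ‖u‖ ≤ R → ‖u'‖ ≤ R →
      ‖(S.P ε).toFun τ ((S.F ε).toFun τ u) - (S.P ε).toFun τ ((S.F ε).toFun τ u')‖ ≤
        1 / 2 * ‖u - u'‖) :
    ∃ u : (S.𝒲 ε).X τ, S.IsSolution ε τ v.1 u ∧ ‖u‖ ≤ R := by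
  set f : (S.𝒲 ε).X τ → (S.𝒲 ε).X τ :=
    fun u => (S.P ε).toFun τ ((S.F ε).toFun τ u) + v.1.1 τ with hf
  set s : Set ((S.𝒲 ε).X τ) := Metric.closedBall 0 R with hs
  have hmem : ∀ {u}, u ∈ s ↔ ‖u‖ ≤ R := mem_closedBall_zero_iff
  have hmaps : Set.MapsTo f s s := fun u hu => by
    refine hmem.2 ((norm_add_le _ _).trans ?_)
    linarith [hb u (hmem.1 hu), v.two_mul_norm_lt hτ]
  -- Banach's theorem is applied on the closed ball, which is complete because the space at time `τ`
  -- is; the iteration starts from `0`.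
  have hcontr : ContractingWith (1 / 2) (hmaps.restrict f s s) := by
    refine ⟨by norm_num, LipschitzWith.of_dist_le_mul fun x y => ?_⟩
    rw [Subtype.dist_eq, Subtype.dist_eq, dist_eq_norm, dist_eq_norm]
    simp only [Set.MapsTo.val_restrict_apply, hf, add_sub_add_right_eq_sub]
    exact_mod_cast hl x y (hmem.1 x.2) (hmem.1 y.2)
  obtain ⟨u, hus, hu, -⟩ := hcontr.exists_fixedPoint' Metric.isClosed_closedBall.isComplete hmaps
    (x := 0) (hmem.2 (by simpa using hR.le)) (edist_ne_top _ _)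
  exact ⟨u, hu.symm, hmem.1 hus⟩

/-- Every solution has norm at most `R` for short times. -/
lemma IsSolution.exists_norm_res_le {R : ℝ} {ε : unitInterval} {v : S.Data R ε} (hR : 0 < R)
    {τ : Time} (hτ : τ ≤ 1) {u : (S.𝒲 ε).X τ} (hu : S.IsSolution ε τ v.1 u) :
    ∃ (s : Time) (hs : s ≤ τ), ‖(S.𝒲 ε).res hs u‖ ≤ R := by
  -- The radius is `‖u‖`, not `R`: restrictions of `u` never leave this ball. Hence `A`, and with it
  -- the time found below, depends on `u`.
  obtain ⟨A, hA0, hA⟩ := S.exists_PF_bound ‖u‖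
  obtain ⟨T, -, hT⟩ := exists_time_mul_rpow_le S.θ_pos hA0 (half_pos hR)
  have hs : min T τ ≤ τ := min_le_right _ _
  refine ⟨min T τ, hs, ?_⟩
  have h1 := (hA ε _ (hs.trans hτ) _ ((S.𝒲 ε).norm_res_le hs u)).trans (hT _ (min_le_left _ _))
  have h2 := v.two_mul_norm_lt (hs.trans hτ)
  -- The restricted solution is replaced by the right-hand side of its own equation, whose two terms
  -- are each at most `R / 2`.
  rw [show (S.𝒲 ε).res hs u = _ from hu.res hs]
  exact (norm_add_le _ _).trans (by linarith)

/-- A solution whose norm is a continuous function of time stays in the ball of radius `R` if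
`𝒫^{(ε)} F_ε` maps it to the ball of radius `R / 2`. -/
lemma IsSolution.norm_le_of_continuous {R : ℝ} {ε : unitInterval} {v : S.Data R ε} (hR : 0 < R)
    {τ : Time} (hτ : τ ≤ 1)
    (hb : ∀ t ≤ τ, ∀ u : (S.𝒲 ε).X t, ‖u‖ ≤ R →
      ‖(S.P ε).toFun t ((S.F ε).toFun t u)‖ ≤ R / 2)
    {u : (S.𝒲 ε).X τ} (hu : S.IsSolution ε τ v.1 u)
    (hc : Continuous (fun t : Set.Iic τ => ‖(S.𝒲 ε).res t.2 u‖)) : ‖u‖ ≤ R := by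
  by_contra! hlt
  -- The norm is at most `R` at time `s` and exceeds `R` at time `τ`. By the intermediate value
  -- theorem on `[s, τ]` it equals `R` at some time, which `norm_lt` forbids.
  obtain ⟨s, hs, hsR⟩ := hu.exists_norm_res_le hR hτ
  let e : Set.Icc (s : ℝ) τ → Set.Iic τ :=
    fun t => ⟨⟨t, lt_of_lt_of_le s.2 t.2.1⟩, t.2.2⟩
  have he : Continuous e := by fun_prop
  have : PreconnectedSpace (Set.Icc (s : ℝ) τ) := Subtype.preconnectedSpace isPreconnected_Icc
  obtain ⟨x, htR⟩ := mem_range_of_exists_le_of_exists_ge (hc.comp he)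
    ⟨⟨s, Set.left_mem_Icc.2 hs⟩, hsR⟩
    ⟨⟨τ, Set.right_mem_Icc.2 hs⟩, hlt.le.trans_eq (congrArg norm ((S.𝒲 ε).res_self u).symm)⟩
  have ht := (e x).2
  exact ((hu.res ht).norm_lt (le_trans ht hτ) (hb _ ht) htR.le).ne htR

end FixedPointSetting

end SingularSPDE

/-! ### Choice of `T` and conclusion -/

open SingularSPDE FixedPointSetting in
theorem mainTheorem4 {n : ℕ} (S : SingularSPDE.FixedPointSetting n) (R : ℝ) (hR : 0 < R) :
    ∃ T : SingularSPDE.Time, T ≤ 1 ∧ ∀ τ : SingularSPDE.Time, τ ≤ T →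
      ∃ sol : ∀ ε : unitInterval, S.Data R ε → (S.𝒲 ε).X τ,
        (∀ (ε : unitInterval) (v : S.Data R ε),
          S.IsSolution ε τ v.1 (sol ε v) ∧ ‖sol ε v‖ ≤ R ∧
          ∀ u : (S.𝒲 ε).X τ, S.IsSolution ε τ v.1 u →
            (‖u‖ ≤ R → u = sol ε v) ∧
            (Continuous (fun t : Set.Iic τ => ‖(S.𝒲 ε).res t.2 u‖) → u = sol ε v) ∧
            ∃ (s : SingularSPDE.Time) (hs : s ≤ τ),
              (S.𝒲 ε).res hs u = (S.𝒲 ε).res hs (sol ε v)) ∧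
        (∀ (v : S.Data R 0) (δ : ℝ), 0 < δ → ∃ ρ : ℝ, 0 < ρ ∧
          ∀ (ε : unitInterval) (v' : S.Data R ε), (ε : ℝ) < ρ →
            S.dist ε τ (v'.1.1 τ) (v.1.1 τ) < ρ →
              S.dist ε τ (sol ε v') (sol 0 v) < δ) := by
  obtain ⟨A₁, hA₁, hb⟩ := S.exists_PF_bound R
  obtain ⟨A₂, hA₂, hl⟩ := S.exists_PF_lipschitz R
  obtain ⟨A₃, hA₃, hd⟩ := S.exists_PF_dist_le R
  -- `T₁` makes the ball of radius `R` go into that of radius `R / 2`, `T₂` gives the contraction,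
  -- and `T₃` lets the distance term be absorbed. None of them depends on `ε` or on the data.
  obtain ⟨T₁, hT₁, h₁⟩ := exists_time_mul_rpow_le S.θ_pos hA₁ (half_pos hR)
  obtain ⟨T₂, -, h₂⟩ := exists_time_mul_rpow_le S.θ_pos hA₂ (c := 1 / 2) (by norm_num)
  obtain ⟨T₃, -, h₃⟩ := exists_time_mul_rpow_le S.θ_pos hA₃ (c := 1 / 2) (by norm_num)
  have hT : min T₁ (min T₂ T₃) ≤ 1 := (min_le_left _ _).trans hT₁
  refine ⟨min T₁ (min T₂ T₃), hT, fun τ hτ => ?_⟩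
  have hτ1 : τ ≤ 1 := hτ.trans hT
  obtain ⟨hτ₁, hτ₂, hτ₃⟩ : τ ≤ T₁ ∧ τ ≤ T₂ ∧ τ ≤ T₃ := by simpa only [le_min_iff] using hτ
  -- The bounds are kept for all `t ≤ τ`, since both uniqueness statements beyond the ball use them
  -- at earlier times.
  have hb' : ∀ ε, ∀ t ≤ τ, ∀ u : (S.𝒲 ε).X t, ‖u‖ ≤ R →
      ‖(S.P ε).toFun t ((S.F ε).toFun t u)‖ ≤ R / 2 := fun ε t ht u hu =>
    (hb ε t (ht.trans hτ1) u hu).trans (h₁ t (ht.trans hτ₁))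
  have hl' : ∀ ε, ∀ t ≤ τ, ∀ u u' : (S.𝒲 ε).X t, ‖u‖ ≤ R → ‖u'‖ ≤ R →
      ‖(S.P ε).toFun t ((S.F ε).toFun t u) - (S.P ε).toFun t ((S.F ε).toFun t u')‖ ≤
        1 / 2 * ‖u - u'‖ := fun ε t ht u u' hu hu' =>
    (hl ε t (ht.trans hτ1) u u' hu hu').trans
      (mul_le_mul_of_nonneg_right (h₂ t (ht.trans hτ₂)) (norm_nonneg _))
  choose sol hsol hsolR using fun (ε : unitInterval) (v : S.Data R ε) =>
    exists_isSolution hR v hτ1 (hb' ε τ le_rfl) (hl' ε τ le_rfl)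
  refine ⟨sol, fun ε v => ⟨hsol ε v, hsolR ε v, fun u hu => ?_⟩, fun v δ hδ => ?_⟩
  · have huniq : ‖u‖ ≤ R → u = sol ε v := fun huR =>
      hu.eq_of_norm_le (hl' ε τ le_rfl) (hsol ε v) huR (hsolR ε v)
    refine ⟨huniq, fun hc => huniq (hu.norm_le_of_continuous hR hτ1 (hb' ε) hc), ?_⟩
    obtain ⟨s, hs, hsR⟩ := hu.exists_norm_res_le hR hτ1
    -- At time `s` both restrictions are solutions in the ball of radius `R`, so uniqueness there
    -- applies.
    exact ⟨s, hs, (hu.res hs).eq_of_norm_le (hl' ε s hs) ((hsol ε v).res hs) hsR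
      (((S.𝒲 ε).norm_res_le hs _).trans (hsolR ε v))⟩
  -- With `d` the distance of the solutions, the estimate is `d < d / 2 + δ / 4 + δ / 4`, one `δ /
  -- 4` for the `o(1)` and one for the data; hence `d < δ`.
  · obtain ⟨ρ, hρ, h⟩ := hd (δ / 4) (by positivity)
    refine ⟨min ρ (δ / 4), lt_min hρ (by positivity), fun ε v' hε hv => ?_⟩
    have hPF := h ε (hε.trans_le (min_le_left _ _)) τ hτ1 _ _ (hsolR ε v') (hsolR 0 v)
    have hadd : S.dist ε τ (sol ε v') (sol 0 v) ≤
        S.dist ε τ ((S.P ε).toFun τ ((S.F ε).toFun τ (sol ε v')))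
          ((S.P 0).toFun τ ((S.F 0).toFun τ (sol 0 v))) + S.dist ε τ (v'.1.1 τ) (v.1.1 τ) := by
      conv_lhs => rw [show sol ε v' = _ from hsol ε v', show sol 0 v = _ from hsol 0 v]
      exact S.dist_add_le ε τ _ _ _ _
    have hhalf := mul_le_mul_of_nonneg_right (h₃ τ hτ₃)
      (S.dist_nonneg ε τ (sol ε v') (sol 0 v))
    linarith [hv.trans_le (min_le_right _ _)]
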